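/- Let $A$ be a (complex, not necessarily unital) C*-algebra. Write $[x,y]=xy-yx$. For subsets $X,Y$ of a ring let $XY$ and $[X,Y]$ denote the additive subgroups generated by $\{xy : x\in X, y\in Y\}$ and $\{[x,y] : x\in X, y\in Y\}$, respectively, let $X^2=XX$, and let $\widetilde{A}$ denote the unitization of $A$ (so that $\widetilde{A}L\widetilde{A}$ is the ideal of $A$ generated by $L$ for a linear subspace $L\subseteq A$). Then the following are equivalent: (1) $A=\widetilde{A}[A,A]\widetilde{A}$, that is, $A$ is generated by its commutators as a (not necessarily closed) two-sided ideal. (2) $A=A[A,A]A$, that is, for every $a\in A$ there exist $n\in\mathbb{N}$ and $b_j,c_j,d_j,e_j\in A$, for $j=1,\ldots,n$, such that $a=\sum_{j=1}^n b_j[c_j,d_j]e_j$. (3) $A=A\big[[A,A],[A,A]\big]A$. (4) $A$ is generated by its commutators as a (not necessarily unital) ring. (5) $A=[A,A]^2$, that is, for every $a\in A$ there exist $n\in\mathbb{N}$ and $b_j,c_j,d_j,e_j\in A$, for $j=1,\ldots,n$, such that $a=\sum_{j=1}^n [b_j,c_j][d_j,e_j]$. Moreover, these conditions imply: (6) $A$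 admits no character, that is, no nonzero $*$-homomorphism $A\to\mathbb{C}$ (equivalently, no one-dimensional irreducible representation). Moreover, (6) implies that $A[A,A]A$ is dense in $A$, and if $A$ is unital, then all of the conditions (1)--(6) are equivalent. -/

import Mathlib

/-- For subsets `X`, `Y` of a ring, `XY`: the additive subgroup generated by the products
`x * y` with `x ∈ X` and `y ∈ Y`. -/
def mulSpan {R : Type*} [NonUnitalRing R] (X Y : Set R) : AddSubgroup R :=
  AddSubgroup.closure {z | ∃ x ∈ X, ∃ y ∈ Y, z = x * y}

/-- For subsets `X`, `Y` of a ring, `[X, Y]`: the additive subgroup generated by the commutators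
`⁅x, y⁆ = x * y - y * x` with `x ∈ X` and `y ∈ Y`. -/
def commSpan {R : Type*} [NonUnitalRing R] (X Y : Set R) : AddSubgroup R :=
  AddSubgroup.closure {z | ∃ x ∈ X, ∃ y ∈ Y, z = ⁅x, y⁆}

/-- The additive subgroup `[A, A]` generated by all commutators of the ring `A`. -/
def commSubgroup (A : Type*) [NonUnitalRing A] : AddSubgroup A :=
  commSpan (Set.univ : Set A) Set.univ

/-- The set of all commutators of the ring `A`. -/
def commSet (A : Type*) [NonUnitalRing A] : Set A :=
  {z | ∃ x y : A, z = ⁅x, y⁆}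

/-- The additive subgroup `A L A` for a subset `L` of the ring `A`. -/
def sandwich {A : Type*} [NonUnitalRing A] (L : Set A) : AddSubgroup A :=
  mulSpan (mulSpan Set.univ L) Set.univ

/-- `A` has a character: a nonzero ⋆-homomorphism to `ℂ` (that is, up to unitary equivalence, a
one-dimensional irreducible representation). -/
def HasCharacter (A : Type*) [NonUnitalCStarAlgebra A] : Prop :=
  ∃ χ : A →⋆ₙₐ[ℂ] ℂ, χ ≠ 0

/-! ### Additive subgroups of a ring, and the purely ring-theoretic step to `[R,R]²` -/

section Subgroups

variable {R : Type*} [NonUnitalRing R]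

/-! The hard implication is (2) ⇒ (3), `sandwich_commSpan_eq_top`. If a self-adjoint `a` lies
outside `I = A[[A,A],[A,A]]A`, functional calculus writes `a = b n * c n` with the `b n` closed
under multiplication, so no `b n` lies in `I`. Zorn's lemma gives a semiprime ideal `P ⊇ I` avoiding
all `b n`. Modulo `P` commutators commute, and a Leibniz argument then makes `A/P` commutative;
hence `A[A,A]A ⊆ P`, contradicting (2). The step (3) ⇒ (5) consists of commutator identities
(`mulSpan_commSubgroup_eq_top`). The same factorization gives `A = AAA`, which removes the
unitization from (1). For (6): a self-adjoint element is a limit of elements `b` with `u * b = b`.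
If `b ∉ A[A,A]A`, the left ideal of all `x` in the unitization with `A x b ⊆ A[A,A]A` is proper and
contains all commutators; a maximal left ideal above it yields a character with value `1` at `u`. -/

lemma mul_mem_mulSpan {X Y : Set R} {x y : R} (hx : x ∈ X) (hy : y ∈ Y) : x * y ∈ mulSpan X Y :=
  AddSubgroup.subset_closure ⟨x, hx, y, hy, rfl⟩

lemma mulSpan_le {X Y : Set R} {S : AddSubgroup R} (h : ∀ x ∈ X, ∀ y ∈ Y, x * y ∈ S) :
    mulSpan X Y ≤ S := by
  refine (AddSubgroup.closure_le S).2 ?_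
  rintro _ ⟨x, hx, y, hy, rfl⟩
  exact h x hx y hy

lemma lie_mem_commSpan {X Y : Set R} {x y : R} (hx : x ∈ X) (hy : y ∈ Y) :
    ⁅x, y⁆ ∈ commSpan X Y :=
  AddSubgroup.subset_closure ⟨x, hx, y, hy, rfl⟩

lemma commSpan_le {X Y : Set R} {S : AddSubgroup R} (h : ∀ x ∈ X, ∀ y ∈ Y, ⁅x, y⁆ ∈ S) :
    commSpan X Y ≤ S := by
  refine (AddSubgroup.closure_le S).2 ?_
  rintro _ ⟨x, hx, y, hy, rfl⟩
  exact h x hx y hy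

lemma lie_mem_commSubgroup (x y : R) : ⁅x, y⁆ ∈ commSubgroup R :=
  lie_mem_commSpan (Set.mem_univ x) (Set.mem_univ y)

lemma commSubgroup_le {S : AddSubgroup R} (h : ∀ x y : R, ⁅x, y⁆ ∈ S) : commSubgroup R ≤ S :=
  commSpan_le fun x _ y _ => h x y

lemma mul_mem_sandwich {L : Set R} {l : R} (x y : R) (hl : l ∈ L) : x * l * y ∈ sandwich L :=
  mul_mem_mulSpan (mul_mem_mulSpan (Set.mem_univ x) hl) (Set.mem_univ y)

lemma sandwich_le {L : Set R} {S : AddSubgroup R} (h : ∀ l ∈ L, ∀ x y, x * l * y ∈ S) :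
    sandwich L ≤ S := by
  refine mulSpan_le fun z hz y _ => ?_
  have : mulSpan Set.univ L ≤ S.comap (AddMonoidHom.mulRight y) :=
    mulSpan_le fun x _ l hl => h l hl x y
  exact this hz

lemma mul_mem_sandwich_left {L : Set R} {z : R} (w : R) (hz : z ∈ sandwich L) :
    w * z ∈ sandwich L := by
  have : sandwich L ≤ (sandwich L).comap (AddMonoidHom.mulLeft w) :=
    sandwich_le fun l hl x y => by
      simpa [mul_assoc] using mul_mem_sandwich (w * x) y hl
  exact this hz

lemma mul_mem_sandwich_right {L : Set R} {z : R} (w : R) (hz : z ∈ sandwich L) :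
    z * w ∈ sandwich L := by
  have : sandwich L ≤ (sandwich L).comap (AddMonoidHom.mulRight w) :=
    sandwich_le fun l hl x y => by
      simpa [mul_assoc] using mul_mem_sandwich x (y * w) hl
  exact this hz

/-- The additive subgroup `sandwich L`, as a two-sided ideal. -/
def sandwichIdeal (L : Set R) : TwoSidedIdeal R :=
  .mk' (sandwich L) (zero_mem _) add_mem neg_mem (mul_mem_sandwich_left _)
    (mul_mem_sandwich_right _)

lemma mem_sandwichIdeal {L : Set R} {x : R} : x ∈ sandwichIdeal L ↔ x ∈ sandwich L :=
  TwoSidedIdeal.mem_mk' ..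

/-- The additive subgroup generated by a set closed under negation consists of finite sums. -/
lemma exists_sum_of_mem_closure {G : Type*} [AddCommGroup G] {T : Set G}
    (hT : ∀ x ∈ T, -x ∈ T) {x : G} (hx : x ∈ AddSubgroup.closure T) :
    ∃ (n : ℕ) (t : Fin n → G), (∀ i, t i ∈ T) ∧ x = ∑ i, t i := by
  induction hx using AddSubgroup.closure_induction with
  | mem x hx => exact ⟨1, fun _ => x, fun _ => hx, by simp⟩
  | zero => exact ⟨0, fun _ => 0, fun i => i.elim0, by simp⟩
  | add x y _ _ ihx ihy =>
    obtain ⟨m, s, hs, rfl⟩ := ihx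
    obtain ⟨n, t, ht, rfl⟩ := ihy
    refine ⟨m + n, Fin.append s t, fun i => ?_, by simp [Fin.sum_univ_add]⟩
    refine Fin.addCases (fun i => ?_) (fun i => ?_) i
    · simpa using hs i
    · simpa using ht i
  | neg x _ ih =>
    obtain ⟨n, t, ht, rfl⟩ := ih
    exact ⟨n, fun i => -t i, fun i => hT _ (ht i), by simp⟩

lemma exists_sum_mul_lie_mul {a : R} (ha : a ∈ sandwich (commSubgroup R : Set R)) :
    ∃ (n : ℕ) (b c d e : Fin n → R), a = ∑ j, b j * ⁅c j, d j⁆ * e j := by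
  let T : Set R := {z | ∃ b c d e : R, z = b * ⁅c, d⁆ * e}
  have hle : sandwich (commSubgroup R : Set R) ≤ AddSubgroup.closure T := by
    refine sandwich_le fun l hl x y => ?_
    have : commSubgroup R ≤ (AddSubgroup.closure T).comap
        ((AddMonoidHom.mulRight y).comp (AddMonoidHom.mulLeft x)) :=
      commSubgroup_le fun c d => AddSubgroup.subset_closure ⟨x, c, d, y, rfl⟩
    exact this hl
  obtain ⟨n, t, ht, rfl⟩ := exists_sum_of_mem_closure (T := T) (by
    rintro _ ⟨b, c, d, e, rfl⟩
    exact ⟨-b, c, d, e, by simp⟩) (hle ha)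
  choose b c d e h using ht
  exact ⟨n, b, c, d, e, Finset.sum_congr rfl fun i _ => h i⟩

lemma exists_sum_lie_mul_lie {a : R}
    (ha : a ∈ mulSpan (commSubgroup R : Set R) (commSubgroup R : Set R)) :
    ∃ (n : ℕ) (b c d e : Fin n → R), a = ∑ j, ⁅b j, c j⁆ * ⁅d j, e j⁆ := by
  let T : Set R := {z | ∃ b c d e : R, z = ⁅b, c⁆ * ⁅d, e⁆}
  have hle : mulSpan (commSubgroup R : Set R) (commSubgroup R : Set R) ≤
      AddSubgroup.closure T := by
    refine mulSpan_le fun x hx y hy => ?_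
    have h1 : ∀ b c, commSubgroup R ≤ (AddSubgroup.closure T).comap
        (AddMonoidHom.mulLeft ⁅b, c⁆) := fun b c =>
      commSubgroup_le fun d e => AddSubgroup.subset_closure ⟨b, c, d, e, rfl⟩
    have h2 : commSubgroup R ≤ (AddSubgroup.closure T).comap (AddMonoidHom.mulRight y) :=
      commSubgroup_le fun b c => h1 b c hy
    exact h2 hx
  obtain ⟨n, t, ht, rfl⟩ := exists_sum_of_mem_closure (T := T) (by
    rintro _ ⟨b, c, d, e, rfl⟩
    exact ⟨c, b, d, e, by rw [← neg_mul, Ring.lie_def, Ring.lie_def c, neg_sub]⟩) (hle ha)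
  choose b c d e h using ht
  exact ⟨n, b, c, d, e, Finset.sum_congr rfl fun i _ => h i⟩

/-- If `R = R[[R,R],[R,R]]R`, then `R = [R,R]²`. -/
theorem mulSpan_commSubgroup_eq_top
    (h : sandwich (commSpan (commSubgroup R : Set R) (commSubgroup R : Set R) : Set R) = ⊤) :
    mulSpan (commSubgroup R : Set R) (commSubgroup R : Set R) = ⊤ := by
  set L := commSubgroup R with hL
  set L2 := mulSpan (L : Set R) (L : Set R) with hL2
  have hmul : ∀ {u v}, u ∈ L → v ∈ L → u * v ∈ L2 := fun hu hv => mul_mem_mulSpan hu hv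
  have hlie : ∀ x y : R, ⁅x, y⁆ ∈ L := lie_mem_commSubgroup
  have hlie2 : ∀ {u v}, u ∈ L → v ∈ L → ⁅u, v⁆ ∈ L2 := fun hu hv => by
    rw [Ring.lie_def]; exact sub_mem (hmul hu hv) (hmul hv hu)
  -- Leibniz for `⁅u, ·⁆` handles a factor on the right; a factor on the left is cycled around
  -- modulo `L`. Together they give `R = L + L²`.
  have key : ∀ u ∈ L, ∀ v ∈ L, ∀ a, ⁅u, v⁆ * a ∈ L ⊔ L2 := fun u hu v hv a => by
    have : ⁅u, v⁆ * a = ⁅u, v * a⁆ - v * ⁅u, a⁆ := by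
      simp only [Ring.lie_def, mul_sub, sub_mul, mul_assoc]; abel
    rw [this]
    exact sub_mem (AddSubgroup.mem_sup_left (hlie _ _))
      (AddSubgroup.mem_sup_right (hmul hv (hlie _ _)))
  have hsum : (⊤ : AddSubgroup R) ≤ L ⊔ L2 := by
    rw [← h]
    refine sandwich_le fun l hl x y => ?_
    have : commSpan (L : Set R) (L : Set R) ≤ (L ⊔ L2).comap
        ((AddMonoidHom.mulRight y).comp (AddMonoidHom.mulLeft x)) := by
      refine commSpan_le fun u hu v hv => ?_
      have e : x * ⁅u, v⁆ * y = ⁅x, ⁅u, v⁆ * y⁆ + ⁅u, v⁆ * (y * x) := by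
        simp only [Ring.lie_def, mul_sub, sub_mul, mul_assoc]; abel
      change x * ⁅u, v⁆ * y ∈ L ⊔ L2
      rw [e]
      exact add_mem (AddSubgroup.mem_sup_left (hlie _ _)) (key u hu v hv _)
    exact this hl
  -- Split `a` along `L + L²`: `⁅u, ·⁆` is a derivation that maps `L` into `L²` and preserves `L²`.
  have hLL2 : ∀ u ∈ L, ∀ a, ⁅u, a⁆ ∈ L2 := by
    intro u hu a
    obtain ⟨l, hl, q, hq, rfl⟩ := AddSubgroup.mem_sup.1 (hsum (AddSubgroup.mem_top a))
    have h2 : L2 ≤ L2.comap (AddMonoidHom.mulLeft u - AddMonoidHom.mulRight u) := by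
      refine mulSpan_le fun v hv w hw => ?_
      change u * (v * w) - v * w * u ∈ L2
      have e : u * (v * w) - v * w * u = ⁅u, v⁆ * w + v * ⁅u, w⁆ := by
        simp only [Ring.lie_def, mul_sub, sub_mul, mul_assoc]; abel
      rw [e]
      exact add_mem (hmul (hlie _ _) hw) (hmul hv (hlie _ _))
    have e : ⁅u, l + q⁆ = ⁅u, l⁆ + (u * q - q * u) := by
      simp only [Ring.lie_def, mul_add, add_mul]; abel
    rw [e]
    exact add_mem (hlie2 hu hl) (h2 hq)
  have hL_le : L ≤ L2 := by
    refine commSubgroup_le fun x y => ?_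
    obtain ⟨l, hl, q, hq, rfl⟩ := AddSubgroup.mem_sup.1 (hsum (AddSubgroup.mem_top x))
    have h2 : L2 ≤ L2.comap (AddMonoidHom.mulRight y - AddMonoidHom.mulLeft y) := by
      refine mulSpan_le fun v hv w hw => ?_
      change v * w * y - y * (v * w) ∈ L2
      -- Rotating the three factors turns `[L², R]` into `[L, R]`, already known to lie in `L²`.
      have e : v * w * y - y * (v * w) = ⁅v, w * y⁆ + ⁅w, y * v⁆ := by
        simp only [Ring.lie_def, mul_assoc]; abel
      rw [e]
      exact add_mem (hLL2 v hv _) (hLL2 w hw _)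
    have e : ⁅l + q, y⁆ = ⁅l, y⁆ + (q * y - y * q) := by
      simp only [Ring.lie_def, mul_add, add_mul]; abel
    rw [e]
    exact add_mem (hLL2 l hl _) (h2 hq)
  exact top_le_iff.1 (hsum.trans (sup_le hL_le le_rfl))

end Subgroups

/-! ### Semiprime ideals and commutativity modulo them -/

section Semiprime

variable {R : Type*} [NonUnitalRing R]

/-- An ideal maximal among those that contain `I` and avoid a multiplicatively closed set is
semiprime. -/
theorem exists_semiprime_disjoint (I : TwoSidedIdeal R) (S : Set R)
    (hmul : ∀ s ∈ S, ∀ t ∈ S, s * t ∈ S) (hI : ∀ s ∈ S, s ∉ I) :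
    ∃ P : TwoSidedIdeal R, I ≤ P ∧ (∀ s ∈ S, s ∉ P) ∧ ∀ x, (∀ y, x * y * x ∈ P) → x ∈ P := by
  obtain ⟨P, hIP, hP⟩ := zorn_le_nonempty₀ {J : TwoSidedIdeal R | I ≤ J ∧ ∀ s ∈ S, s ∉ J} (by
    intro c hc hchain J₀ hJ₀
    have key : ∀ J ∈ c, ∀ K ∈ c, ∃ M ∈ c, J ≤ M ∧ K ≤ M := fun J hJ K hK => by
      rcases hchain.total hJ hK with h | h
      · exact ⟨K, hK, h, le_rfl⟩
      · exact ⟨J, hJ, le_rfl, h⟩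
    let U : TwoSidedIdeal R := .mk' {x | ∃ J ∈ c, x ∈ J} ⟨J₀, hJ₀, zero_mem _⟩
      (by
        rintro x y ⟨J, hJ, hx⟩ ⟨K, hK, hy⟩
        obtain ⟨M, hM, h1, h2⟩ := key J hJ K hK
        exact ⟨M, hM, add_mem (h1 hx) (h2 hy)⟩)
      (by rintro x ⟨J, hJ, hx⟩; exact ⟨J, hJ, neg_mem hx⟩)
      (by rintro x y ⟨J, hJ, hx⟩; exact ⟨J, hJ, J.mul_mem_left _ _ hx⟩)
      (by rintro x y ⟨J, hJ, hx⟩; exact ⟨J, hJ, J.mul_mem_right _ _ hx⟩)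
    have hU : ∀ x, x ∈ U ↔ ∃ J ∈ c, x ∈ J := fun x => TwoSidedIdeal.mem_mk' ..
    refine ⟨U, ⟨fun x hx => (hU x).2 ⟨J₀, hJ₀, (hc hJ₀).1 hx⟩, fun s hs hsU => ?_⟩,
      fun J hJ x hx => (hU x).2 ⟨J, hJ, hx⟩⟩
    obtain ⟨J, hJ, hsJ⟩ := (hU s).1 hsU
    exact (hc hJ).2 s hs hsJ) I ⟨le_rfl, hI⟩
  refine ⟨P, hIP, hP.prop.2, fun x hx => ?_⟩
  by_contra hxP
  -- By maximality, any ideal containing `P` and `x` meets `S`. Applied to `{z | xRz ⊆ P}` and then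
  -- to `{z | zRs ⊆ P}`, this gives `s, t ∈ S` with `tRs ⊆ P`, whence `t * s * s ∈ P`.
  have meets : ∀ J : TwoSidedIdeal R, P ≤ J → x ∈ J → ∃ s ∈ S, s ∈ J := fun J hPJ hxJ => by
    by_contra! hJ
    exact hxP (hP.le_of_ge ⟨hIP.trans hPJ, hJ⟩ hPJ hxJ)
  let T₁ : TwoSidedIdeal R := .mk' {z | ∀ y, x * y * z ∈ P} (by simp [zero_mem])
    (fun h₁ h₂ y => by rw [mul_add]; exact add_mem (h₁ y) (h₂ y))
    (fun h y => by rw [mul_neg]; exact neg_mem (h y))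
    (fun {w z} h y => by simpa only [mul_assoc] using h (y * w))
    (fun {z w} h y => by rw [← mul_assoc]; exact P.mul_mem_right _ _ (h y))
  have hT₁ : ∀ z, z ∈ T₁ ↔ ∀ y, x * y * z ∈ P := fun z => TwoSidedIdeal.mem_mk' ..
  obtain ⟨s, hs, hsT⟩ := meets T₁ (fun z hz => (hT₁ z).2 fun y => P.mul_mem_left _ _ hz)
    ((hT₁ x).2 hx)
  rw [hT₁] at hsT
  let T₂ : TwoSidedIdeal R := .mk' {z | ∀ y, z * y * s ∈ P} (by simp [zero_mem])
    (fun h₁ h₂ y => by rw [add_mul, add_mul]; exact add_mem (h₁ y) (h₂ y))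
    (fun h y => by rw [neg_mul, neg_mul]; exact neg_mem (h y))
    (fun {w z} h y => by rw [mul_assoc w, mul_assoc w]; exact P.mul_mem_left _ _ (h y))
    (fun {z w} h y => by simpa only [mul_assoc] using h (w * y))
  have hT₂ : ∀ z, z ∈ T₂ ↔ ∀ y, z * y * s ∈ P := fun z => TwoSidedIdeal.mem_mk' ..
  obtain ⟨t, ht, htT⟩ := meets T₂
    (fun z hz => (hT₂ z).2 fun y => P.mul_mem_right _ _ (P.mul_mem_right _ _ hz))
    ((hT₂ x).2 hsT)
  exact hP.prop.2 _ (hmul _ (hmul t ht s hs) s hs) ((hT₂ t).1 htT s)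

/-- An inner derivation that squares to zero modulo a `2`-torsion-free semiprime ideal vanishes
modulo that ideal. -/
theorem lie_mem_of_lie_lie_mem {P : TwoSidedIdeal R} (hP : ∀ x, (∀ y, x * y * x ∈ P) → x ∈ P)
    (h2 : ∀ x, x + x ∈ P → x ∈ P) {u : R} (hu : ∀ x, ⁅u, ⁅u, x⁆⁆ ∈ P) (x : R) : ⁅u, x⁆ ∈ P := by
  have h1 : ∀ x y, ⁅u, x⁆ * ⁅u, y⁆ ∈ P := fun x y => by
    refine h2 _ ?_
    -- Second-order Leibniz rule: with `D = ⁅u, ·⁆`, `2 Dx Dy = D²(xy) - (D²x) y - x D²y`.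
    have e : ⁅u, x⁆ * ⁅u, y⁆ + ⁅u, x⁆ * ⁅u, y⁆ =
        ⁅u, ⁅u, x * y⁆⁆ - ⁅u, ⁅u, x⁆⁆ * y - x * ⁅u, ⁅u, y⁆⁆ := by
      simp only [Ring.lie_def, mul_sub, sub_mul, mul_assoc]; abel
    rw [e]
    exact sub_mem (sub_mem (hu _) (P.mul_mem_right _ _ (hu _))) (P.mul_mem_left _ _ (hu _))
  refine hP _ fun y => ?_
  have e : ⁅u, x⁆ * y * ⁅u, x⁆ = ⁅u, x⁆ * ⁅u, y * x⁆ - ⁅u, x⁆ * ⁅u, y⁆ * x := by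
    simp only [Ring.lie_def, mul_sub, sub_mul, mul_assoc]; abel
  rw [e]
  exact sub_mem (h1 _ _) (P.mul_mem_right _ _ (h1 _ _))

/-- A ring whose commutators commute modulo a `2`-torsion-free semiprime ideal is commutative modulo
that ideal. -/
theorem lie_mem_of_sandwich_le {P : TwoSidedIdeal R} (hP : ∀ x, (∀ y, x * y * x ∈ P) → x ∈ P)
    (h2 : ∀ x, x + x ∈ P → x ∈ P)
    (h : ∀ x ∈ sandwich (commSpan (commSubgroup R : Set R) (commSubgroup R : Set R) : Set R),
      x ∈ P) (x y : R) : ⁅x, y⁆ ∈ P := by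
  have h1 : ∀ x ∈ commSpan (commSubgroup R : Set R) (commSubgroup R : Set R), x ∈ P := by
    -- Semiprimeness is used twice so that `x` acquires a factor on each side, as membership in
    -- `sandwich` requires.
    refine fun x hx => hP _ fun y => hP _ fun z => h _ ?_
    have : x * y * x * z * (x * y * x) = (x * y) * x * (z * (x * y * x)) := by
      simp only [mul_assoc]
    rw [this]
    exact mul_mem_sandwich _ _ hx
  have h3 : ∀ u ∈ commSubgroup R, ∀ x, ⁅u, x⁆ ∈ P := fun u hu x =>
    lie_mem_of_lie_lie_mem hP h2
      (fun x => h1 _ (lie_mem_commSpan hu (lie_mem_commSubgroup u x))) x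
  refine lie_mem_of_lie_lie_mem hP h2 (fun y => ?_) y
  have e : ⁅x, ⁅x, y⁆⁆ = -⁅⁅x, y⁆, x⁆ := by simp only [Ring.lie_def]; abel
  rw [e]
  exact neg_mem (h3 _ (lie_mem_commSubgroup x y) x)

end Semiprime

/-! ### Factorization and approximation by functional calculus -/

section Factorization

open Filter Topology

/-- `Real.log t` is `log |t|`, and the convention `log 0 = 0`, `0⁻¹ = 0` supplies exactly the limit
at `0`. -/
lemma continuousOn_neg_inv_log :
    ContinuousOn (fun t : ℝ => -(Real.log t)⁻¹) (Set.Ioo (-1) 1) := by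
  intro t ht
  refine ContinuousAt.continuousWithinAt ?_
  rcases eq_or_ne t 0 with rfl | h0
  · rw [continuousAt_iff_punctured_nhds]
    simpa using (tendsto_inv_atBot_zero.comp Real.tendsto_log_nhdsNE_zero).neg
  · have : Real.log t ≠ 0 := by
      rw [Real.log_ne_zero]
      exact ⟨h0, ht.2.ne, ht.1.ne'⟩
    exact ((Real.continuousAt_log h0).inv₀ this).neg

lemma continuous_mul_neg_log_pow (n : ℕ) :
    Continuous (fun t : ℝ => t * (-Real.log t) ^ n) := by
  refine continuous_iff_continuousAt.2 fun t => ?_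
  rcases eq_or_ne t 0 with rfl | h0
  · rw [continuousAt_iff_punctured_nhds]
    have h := (Real.isLittleO_pow_log_id_atTop (n := n)).tendsto_div_nhds_zero.comp
      (tendsto_norm_inv_nhdsNE_zero_atTop (α := ℝ))
    rw [zero_mul, tendsto_zero_iff_abs_tendsto_zero]
    refine ((tendsto_zero_iff_abs_tendsto_zero _).1 h).congr fun t => ?_
    simp [abs_mul, mul_comm, abs_pow]
  · exact continuousAt_id.mul ((Real.continuousAt_log h0).neg.pow n)

variable {A : Type*} [NonUnitalCStarAlgebra A]

/-- A self-adjoint element `a` is divisible by every member of some multiplicatively closed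
sequence. -/
theorem IsSelfAdjoint.exists_pow_mul_eq {a : A} (ha : IsSelfAdjoint a) :
    ∃ b c : ℕ → A, (∀ n, b n * c n = a) ∧ ∀ m n, b m * b n = b (m + n + 1) := by
  obtain ⟨r, hr0, hr⟩ : ∃ r > 0, ∀ t ∈ quasispectrum ℝ a, t / r ∈ Set.Ioo (-1 : ℝ) 1 := by
    obtain ⟨C, hC⟩ := (NonUnitalContinuousFunctionalCalculus.isCompact_quasispectrum
      (R := ℝ) (p := IsSelfAdjoint) a).isBounded.exists_norm_le
    have hC0 : 0 < |C| + 1 := by positivity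
    refine ⟨|C| + 1, hC0, fun t ht => ?_⟩
    have h : |t| ≤ C := hC t ht
    rw [Set.mem_Ioo, ← abs_lt, abs_div, abs_of_pos hC0, div_lt_one hC0]
    linarith [le_abs_self C]
  have hdiv : ContinuousOn (fun t : ℝ => t / r) (quasispectrum ℝ a) := by fun_prop
  have hf : ∀ n : ℕ, ContinuousOn (fun t : ℝ => (-(Real.log (t / r))⁻¹) ^ (n + 1))
      (quasispectrum ℝ a) := fun n =>
    (continuousOn_neg_inv_log.comp hdiv hr).pow (n + 1)
  have hg : ∀ n : ℕ, ContinuousOn (fun t : ℝ => r * (t / r * (-Real.log (t / r)) ^ (n + 1)))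
      (quasispectrum ℝ a) := fun n =>
    continuousOn_const.mul ((continuous_mul_neg_log_pow (n + 1)).comp_continuousOn hdiv)
  -- Powers of `-1 / log |t / r|` tend to `0` at `0` more slowly than `t`, so each divides `t`
  -- continuously. The exponent `n + 1` keeps the value at `0` equal to `0`.
  refine ⟨fun n => cfcₙ (fun t : ℝ => (-(Real.log (t / r))⁻¹) ^ (n + 1)) a,
    fun n => cfcₙ (fun t : ℝ => r * (t / r * (-Real.log (t / r)) ^ (n + 1))) a,
    fun n => ?_, fun m n => ?_⟩
  · rw [← cfcₙ_mul _ _ a (hf n) (by simp) (hg n) (by simp)]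
    conv_rhs => rw [← cfcₙ_id' ℝ a]
    refine cfcₙ_congr fun t ht => ?_
    rcases eq_or_ne t 0 with rfl | h0
    · simp
    · have hl : Real.log (t / r) ≠ 0 := by
        rw [Real.log_ne_zero]
        exact ⟨div_ne_zero h0 hr0.ne', (hr t ht).2.ne, (hr t ht).1.ne'⟩
      rw [neg_inv, inv_pow]
      have : (-Real.log (t / r)) ^ (n + 1) ≠ 0 := pow_ne_zero _ (neg_ne_zero.2 hl)
      field_simp
  · rw [← cfcₙ_mul _ _ a (hf m) (by simp) (hf n) (by simp)]
    congr 1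
    ext t
    ring

/-- An additive subgroup that contains `λ • a` for all self-adjoint `a` is everything. -/
lemma addSubgroup_eq_top_of_smul_selfAdjoint {S : AddSubgroup A}
    (h : ∀ (z : ℂ) (a : A), IsSelfAdjoint a → z • a ∈ S) : S = ⊤ := by
  refine top_le_iff.1 fun a _ => ?_
  rw [← realPart_add_I_smul_imaginaryPart a]
  refine add_mem ?_ (h _ _ (imaginaryPart a).2)
  simpa using h 1 _ (realPart a).2

/-- A self-adjoint element equals `b 0 * b 0 * c 1`, and a scalar is absorbed by the first factor.
-/
lemma addSubgroup_eq_top_of_mul_mul_mem {S : AddSubgroup A} (h : ∀ x y z : A, x * y * z ∈ S) :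
    S = ⊤ := by
  refine addSubgroup_eq_top_of_smul_selfAdjoint fun z a ha => ?_
  obtain ⟨b, c, hbc, hb⟩ := ha.exists_pow_mul_eq
  rw [← hbc 1, ← hb 0 0, ← smul_mul_assoc, ← smul_mul_assoc]
  exact h _ _ _

lemma smul_mem_sandwich {L : Set A} {x : A} (z : ℂ) (hx : x ∈ sandwich L) :
    z • x ∈ sandwich L := by
  have : sandwich L ≤ (sandwich L).comap (DistribSMul.toAddMonoidHom A z) :=
    sandwich_le fun l hl x y => by
      simpa [smul_mul_assoc] using mul_mem_sandwich (z • x) y hl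
  exact this hx

/-- If `A = A[A,A]A`, then `A = A[[A,A],[A,A]]A`. -/
theorem sandwich_commSpan_eq_top (h : sandwich (commSubgroup A : Set A) = ⊤) :
    sandwich (commSpan (commSubgroup A : Set A) (commSubgroup A : Set A) : Set A) = ⊤ := by
  refine addSubgroup_eq_top_of_smul_selfAdjoint fun z a ha => smul_mem_sandwich z ?_
  by_contra haI
  obtain ⟨b, c, hbc, hb⟩ := ha.exists_pow_mul_eq
  obtain ⟨P, hIP, hSP, hP⟩ := exists_semiprime_disjoint
    (sandwichIdeal (commSpan (commSubgroup A : Set A) (commSubgroup A : Set A) : Set A))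
    (Set.range b)
    (by rintro _ ⟨m, rfl⟩ _ ⟨n, rfl⟩; exact ⟨_, (hb m n).symm⟩)
    (by
      rintro _ ⟨n, rfl⟩ hn
      rw [mem_sandwichIdeal] at hn
      exact haI (hbc n ▸ mul_mem_sandwich_right _ hn))
  -- `P` is only a ring ideal, not assumed stable under scalars, so the factor `1/2` is moved onto
  -- `y`.
  have h2 : ∀ x, x + x ∈ P → x ∈ P := fun x hx => hP _ fun y => by
    have e : x * y * x = (x + x) * (((1 / 2 : ℂ) • y) * x) := by
      rw [← two_smul ℂ x, smul_mul_assoc, smul_mul_assoc, mul_smul_comm, smul_smul, mul_assoc]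
      norm_num
    rw [e]
    exact P.mul_mem_right _ _ hx
  have hcomm := lie_mem_of_sandwich_le hP h2 fun x hx => hIP (mem_sandwichIdeal.2 hx)
  let PA : AddSubgroup A :=
    { carrier := P, add_mem' := P.add_mem, zero_mem' := P.zero_mem, neg_mem' := P.neg_mem }
  have hle : commSubgroup A ≤ PA := commSubgroup_le hcomm
  have : sandwich (commSubgroup A : Set A) ≤ PA := sandwich_le fun l hl x y =>
    P.mul_mem_right _ _ (P.mul_mem_left _ _ (hle hl))
  exact hSP (b 0) ⟨0, rfl⟩ (this (h ▸ AddSubgroup.mem_top (b 0)))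

/-- A self-adjoint element is approximated by elements that have a left unit. -/
theorem IsSelfAdjoint.exists_mul_eq_norm_sub_le {a : A} (ha : IsSelfAdjoint a) {ε : ℝ}
    (hε : 0 < ε) : ∃ u b : A, u * b = b ∧ ‖a - b‖ ≤ ε := by
  have hfc : Continuous fun t : ℝ => t - max (-ε) (min t ε) := by fun_prop
  have huc : Continuous fun t : ℝ => min 1 (|t| / ε) := by fun_prop
  have hf0 : (0 : ℝ) - max (-ε) (min 0 ε) = 0 := by simp [hε.le]
  -- `b` is the soft threshold of `a` at level `ε`: it vanishes for `|t| ≤ ε`, while `u` is `1` for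
  -- `|t| ≥ ε`.
  refine ⟨cfcₙ (fun t : ℝ => min 1 (|t| / ε)) a,
    cfcₙ (fun t : ℝ => t - max (-ε) (min t ε)) a, ?_, ?_⟩
  · rw [← cfcₙ_mul _ _ a huc.continuousOn (by simp) hfc.continuousOn hf0]
    refine cfcₙ_congr fun t _ => ?_
    rcases le_total ε |t| with h | h
    · rw [min_eq_left ((one_le_div hε).2 h), one_mul]
    · rw [abs_le] at h
      rw [min_eq_left h.2, max_eq_right h.1, sub_self, mul_zero]
  · have e : a - cfcₙ (fun t : ℝ => t - max (-ε) (min t ε)) a =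
        cfcₙ (fun t : ℝ => t - (t - max (-ε) (min t ε))) a := by
      rw [cfcₙ_sub (fun t : ℝ => t) _ a continuousOn_id rfl hfc.continuousOn hf0, cfcₙ_id' ℝ a]
    rw [e]
    refine norm_cfcₙ_le fun t _ => ?_
    rw [sub_sub_cancel, Real.norm_eq_abs, abs_le]
    exact ⟨le_max_left _ _, max_le (by linarith) (min_le_right _ _)⟩

end Factorization

/-! ### Characters from maximal left ideals containing all commutators -/

section Character

variable {B : Type*} [CStarAlgebra B]

lemma Ideal.mul_mem_right_of_lie_mem {R : Type*} [Ring R] {M : Ideal R}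
    (hc : ∀ x y : R, ⁅x, y⁆ ∈ M) {x : R} (y : R) (hx : x ∈ M) : x * y ∈ M := by
  have e : x * y = ⁅x, y⁆ + y * x := by rw [Ring.lie_def]; abel
  rw [e]
  exact add_mem (hc x y) (M.mul_mem_left y hx)

/-- Such an `M` is two-sided with a field as quotient: cancel `x` using a left inverse modulo `M`.
-/
lemma Ideal.IsMaximal.mem_or_mem_of_lie_mem {R : Type*} [Ring R] {M : Ideal R} (hM : M.IsMaximal)
    (hc : ∀ x y : R, ⁅x, y⁆ ∈ M) {x y : R} (hxy : x * y ∈ M) : x ∈ M ∨ y ∈ M := by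
  refine or_iff_not_imp_left.2 fun hx => ?_
  obtain ⟨z, hz⟩ := hM.exists_inv hx
  obtain ⟨i, hi, hzi⟩ := hz
  have e : y = z * (x * y) + i * y := by rw [← mul_assoc, ← add_mul, hzi, one_mul]
  rw [e]
  exact add_mem (M.mul_mem_left _ hxy) (Ideal.mul_mem_right_of_lie_mem hc _ hi)

/-- Modulo a maximal left ideal containing all commutators, a self-adjoint element is a scalar. -/
theorem IsSelfAdjoint.exists_sub_algebraMap_mem {M : Ideal B} (hM : M.IsMaximal)
    (hc : ∀ x y : B, ⁅x, y⁆ ∈ M) {a : B} (ha : IsSelfAdjoint a) :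
    ∃ s : ℝ, a - algebraMap ℝ B s ∈ M := by
  let φ := cfcHom (R := ℝ) (a := a) ha
  let I : Ideal C(spectrum ℝ a, ℝ) := M.comap (φ : C(spectrum ℝ a, ℝ) →+* B)
  have hI : ∀ f, f ∈ I ↔ φ f ∈ M := fun f => Iff.rfl
  have hI1 : I ≠ ⊤ := by
    rw [Ne, Ideal.eq_top_iff_one, hI, map_one, ← Ideal.eq_top_iff_one]
    exact hM.ne_top
  -- Maximal ideals of `C(spectrum ℝ a, ℝ)` are points of the spectrum; the point `s` found here is
  -- the required scalar.
  obtain ⟨J, hJ, hIJ⟩ := Ideal.exists_le_maximal I hI1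
  obtain ⟨s, hs⟩ := ContinuousMap.setOfIdeal_eq_compl_singleton J
  have hIs : ∀ f ∈ I, f s = 0 := fun f hf => by
    have : s ∉ ContinuousMap.setOfIdeal J := by simp [hs]
    exact ContinuousMap.notMem_setOfIdeal.1 this (hIJ hf)
  refine ⟨s, ?_⟩
  have hclosed : IsClosed (M : Set B) := Ideal.IsMaximal.isClosed
  rw [← SetLike.mem_coe, ← hclosed.closure_eq, Metric.mem_closure_iff]
  intro ε hε
  let p : C(spectrum ℝ a, ℝ) := ⟨fun t => (t : ℝ) - s, by fun_prop⟩
  -- `f` is within `ε / 2` of `p` and vanishes near `s`, where the bump `g` lives. Since `g s ≠ 0`,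
  -- `φ g ∉ M`, so `g * f = 0` forces `φ f ∈ M`; closedness of `M` then gives `φ p ∈ M`.
  let f : C(spectrum ℝ a, ℝ) :=
    ⟨fun t => (t - s : ℝ) - max (-(ε / 2)) (min (t - s : ℝ) (ε / 2)), by fun_prop⟩
  let g : C(spectrum ℝ a, ℝ) := ⟨fun t => max 0 (ε / 2 - |(t - s : ℝ)|), by fun_prop⟩
  have hgf : g * f = 0 := by
    ext t
    change max 0 (ε / 2 - |(t - s : ℝ)|) * ((t - s : ℝ) - max (-(ε / 2)) (min (t - s : ℝ) (ε / 2)))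
      = 0
    rcases le_total (ε / 2) |(t - s : ℝ)| with h | h
    · rw [max_eq_left (by linarith), zero_mul]
    · rw [abs_le] at h
      rw [min_eq_left h.2, max_eq_right h.1, sub_self, mul_zero]
  have hfM : φ f ∈ M := by
    refine (hM.mem_or_mem_of_lie_mem hc (x := φ g) (y := φ f) ?_).resolve_left fun hg => ?_
    · rw [← map_mul, hgf, map_zero]
      exact zero_mem M
    · have h := hIs g hg
      have : g s = ε / 2 := by
        change max 0 (ε / 2 - |(s - s : ℝ)|) = ε / 2
        rw [sub_self, abs_zero, sub_zero, max_eq_right (by linarith)]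
      linarith
  have hp : φ p = a - algebraMap ℝ B s := by
    have e : p = (ContinuousMap.id ℝ).restrict (spectrum ℝ a) -
        algebraMap ℝ C(spectrum ℝ a, ℝ) s := rfl
    rw [e, map_sub, cfcHom_id, AlgHomClass.commutes]
  refine ⟨φ f, hfM, ?_⟩
  rw [← hp, (isometry_cfcHom (R := ℝ) a ha).dist_eq]
  refine lt_of_le_of_lt ((ContinuousMap.dist_le (by linarith)).2 fun t => ?_) (half_lt_self hε)
  change |(t - s : ℝ) - ((t - s : ℝ) - max (-(ε / 2)) (min (t - s : ℝ) (ε / 2)))| ≤ ε / 2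
  rw [sub_sub_cancel, abs_le]
  exact ⟨le_max_left _ _, max_le (by linarith) (min_le_right _ _)⟩

/-- A maximal left ideal containing all commutators is the kernel of a character. -/
theorem Ideal.IsMaximal.exists_starAlgHom {M : Ideal B} (hM : M.IsMaximal)
    (hc : ∀ x y : B, ⁅x, y⁆ ∈ M) : ∃ χ : B →⋆ₐ[ℂ] ℂ, ∀ x ∈ M, χ x = 0 := by
  have hex : ∀ x : B, ∃ z : ℂ, x - algebraMap ℂ B z ∈ M := fun x => by
    obtain ⟨s, hs⟩ := (realPart x).2.exists_sub_algebraMap_mem hM hc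
    obtain ⟨t, ht⟩ := (imaginaryPart x).2.exists_sub_algebraMap_mem hM hc
    refine ⟨s + Complex.I * t, ?_⟩
    have e : x - algebraMap ℂ B (s + Complex.I * t) = (realPart x - algebraMap ℝ B s) +
        algebraMap ℂ B Complex.I * (imaginaryPart x - algebraMap ℝ B t) := by
      conv_lhs => rw [← realPart_add_I_smul_imaginaryPart x]
      rw [IsScalarTower.algebraMap_apply ℝ ℂ B, IsScalarTower.algebraMap_apply ℝ ℂ B t,
        Algebra.smul_def, map_add, map_mul, mul_sub]
      simp only [Complex.coe_algebraMap]
      abel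
    rw [e]
    exact add_mem hs (M.mul_mem_left _ ht)
  have h0 : ∀ z : ℂ, algebraMap ℂ B z ∈ M → z = 0 := fun z hz => by
    by_contra hz0
    refine hM.ne_top ((Ideal.eq_top_iff_one M).2 ?_)
    rw [← map_one (algebraMap ℂ B), ← inv_mul_cancel₀ hz0, map_mul]
    exact M.mul_mem_left _ hz
  choose f hf using hex
  have huniq : ∀ x z, x - algebraMap ℂ B z ∈ M → f x = z := fun x z hz => by
    refine sub_eq_zero.1 (h0 _ ?_)
    have := sub_mem hz (hf x)
    rwa [sub_sub_sub_cancel_left, ← map_sub] at this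
  let χ : B →ₐ[ℂ] ℂ :=
    { toFun := f
      map_one' := huniq _ _ (by simp)
      map_zero' := huniq _ _ (by simp)
      map_add' := fun x y => huniq _ _ (by
        rw [map_add, add_sub_add_comm]; exact add_mem (hf x) (hf y))
      map_mul' := fun x y => huniq _ _ (by
        have e : x * y - algebraMap ℂ B (f x * f y) =
            x * (y - algebraMap ℂ B (f y)) + algebraMap ℂ B (f y) * (x - algebraMap ℂ B (f x)) := by
          rw [mul_sub, mul_sub, ← Algebra.commutes (f y) x, ← map_mul, mul_comm (f y)]; abel
        rw [e]
        exact add_mem (M.mul_mem_left _ (hf y)) (M.mul_mem_left _ (hf x)))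
      commutes' := fun z => huniq _ _ (by simp) }
  exact ⟨{ χ with
      -- Algebra homomorphisms from a C⋆-algebra to `ℂ` preserve the star automatically.
      map_star' := fun x => (AlgHomClass.instStarHomClass (F := B →ₐ[ℂ] ℂ)).map_star χ x },
    fun x hx => huniq x 0 (by simpa using hx)⟩

variable {A : Type*} [NonUnitalCStarAlgebra A]

lemma Unitization.lie_eq_inr (x y : Unitization ℂ A) :
    ⁅x, y⁆ = ((⁅x.snd, y.snd⁆ : A) : Unitization ℂ A) := by
  ext
  · change x.fst * y.fst - y.fst * x.fst = 0
    rw [mul_comm, sub_self]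
  · change (x * y).snd - (y * x).snd = x.snd * y.snd - y.snd * x.snd
    rw [Unitization.snd_mul, Unitization.snd_mul]
    abel

/-- A C⋆-algebra with an element outside `A[A,A]A` that has a left unit has a character. -/
theorem hasCharacter_of_mul_eq {u b : A} (hub : u * b = b)
    (hb : b ∉ sandwich (commSubgroup A : Set A)) : HasCharacter A := by
  let S : AddSubgroup (Unitization ℂ A) :=
    (sandwich (commSubgroup A : Set A)).map
      (Unitization.inrNonUnitalAlgHom ℂ A : A →+ Unitization ℂ A)
  have hS : ∀ x : A, (x : Unitization ℂ A) ∈ S ↔ x ∈ sandwich (commSubgroup A : Set A) := fun x =>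
    ⟨fun ⟨y, hy, hyx⟩ => Unitization.inr_injective hyx ▸ hy, fun hx => ⟨x, hx, rfl⟩⟩
  -- `u` witnesses that `K` is proper, since `u * 1 * b = b`; and `(u - 1) * b = 0` puts `u - 1` in
  -- `K`, so the resulting character cannot vanish on `A`.
  let K : Ideal (Unitization ℂ A) :=
    { carrier := {x | ∀ c : A, (c : Unitization ℂ A) * x * b ∈ S}
      zero_mem' := fun c => by simp [zero_mem]
      add_mem' := fun hx hy c => by rw [mul_add, add_mul]; exact add_mem (hx c) (hy c)
      smul_mem' := fun y x hx c => by
        have e : (c : Unitization ℂ A) * y = ((c * y : Unitization ℂ A).snd : Unitization ℂ A) := by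
          ext <;> simp
        rw [smul_eq_mul, ← mul_assoc, e]
        exact hx _ }
  have hK : ∀ x, x ∈ K ↔ ∀ c : A, (c : Unitization ℂ A) * x * b ∈ S := fun x => Iff.rfl
  have hK1 : K ≠ ⊤ := by
    rw [Ne, Ideal.eq_top_iff_one, hK]
    intro h
    have := h u
    rw [mul_one, ← Unitization.inr_mul, hub, hS] at this
    exact hb this
  obtain ⟨M, hM, hKM⟩ := Ideal.exists_le_maximal K hK1
  obtain ⟨χ, hχ⟩ := hM.exists_starAlgHom fun x y => hKM ((hK _).2 fun c => by
    rw [Unitization.lie_eq_inr, ← Unitization.inr_mul, ← Unitization.inr_mul, hS]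
    exact mul_mem_sandwich _ _ (lie_mem_commSubgroup _ _))
  have hu : (u : Unitization ℂ A) - 1 ∈ M := hKM ((hK _).2 fun c => by
    rw [mul_assoc, sub_mul, one_mul, ← Unitization.inr_mul, hub, sub_self, mul_zero]
    exact zero_mem S)
  refine ⟨(χ : Unitization ℂ A →⋆ₙₐ[ℂ] ℂ).comp (Unitization.inrNonUnitalStarAlgHom ℂ A),
    fun h => ?_⟩
  have h1 : χ (u : Unitization ℂ A) = 0 := DFunLike.congr_fun h u
  have h2 := hχ _ hu
  rw [map_sub, h1, map_one] at h2
  norm_num at h2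

/-- Characters obstruct `A = [A,A]²`. -/
theorem not_hasCharacter_of_mulSpan_eq_top
    (h : mulSpan (commSubgroup A : Set A) (commSubgroup A : Set A) = ⊤) : ¬ HasCharacter A := by
  rintro ⟨χ, hχ⟩
  refine hχ (NonUnitalStarAlgHom.ext fun a => ?_)
  have hle : commSubgroup A ≤ (χ : A →+ ℂ).ker := commSubgroup_le fun x y => by
    simp [AddMonoidHom.mem_ker, Ring.lie_def, mul_comm]
  have : mulSpan (commSubgroup A : Set A) (commSubgroup A : Set A) ≤ (χ : A →+ ℂ).ker :=
    mulSpan_le fun x hx y _ => by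
      have hx0 : χ x = 0 := hle hx
      simp [AddMonoidHom.mem_ker, hx0]
  exact this (h ▸ AddSubgroup.mem_top a)

/-- A C⋆-algebra without characters is the closure of `A[A,A]A`. -/
theorem dense_sandwich_of_not_hasCharacter (h : ¬ HasCharacter A) :
    Dense (sandwich (commSubgroup A : Set A) : Set A) := by
  have htop : (sandwich (commSubgroup A : Set A)).topologicalClosure = ⊤ := by
    refine addSubgroup_eq_top_of_smul_selfAdjoint fun z a ha => ?_
    change z • a ∈ closure (sandwich (commSubgroup A : Set A) : Set A)
    have hmem : a ∈ closure (sandwich (commSubgroup A : Set A) : Set A) := by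
      refine Metric.mem_closure_iff.2 fun ε hε => ?_
      obtain ⟨u, b, hub, hab⟩ := ha.exists_mul_eq_norm_sub_le (half_pos hε)
      refine ⟨b, by_contra fun hb => h (hasCharacter_of_mul_eq hub hb), ?_⟩
      rw [dist_eq_norm]
      linarith
    exact map_mem_closure (continuous_const_smul z) hmem fun x hx => smul_mem_sandwich z hx
  intro a
  have : a ∈ (sandwich (commSubgroup A : Set A)).topologicalClosure := htop ▸ AddSubgroup.mem_top a
  exact this

end Character

/-! ### Comparison with the ideal generated by commutators, and assembly -/

section Main

variable {A : Type*} [NonUnitalCStarAlgebra A]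

/-- If the two-sided ideal generated by the commutators is everything, then `A = A[A,A]A`. -/
theorem sandwich_eq_top_of_span_eq_top (h : TwoSidedIdeal.span (commSet A) = ⊤) :
    sandwich (commSubgroup A : Set A) = ⊤ := by
  -- `J` is an ideal containing the commutators, hence all of `A`; so `AAA ⊆ A[A,A]A`, and `A = AAA`
  -- finishes.
  let J : TwoSidedIdeal A := .mk' {z | ∀ x y, x * z * y ∈ sandwich (commSubgroup A : Set A)}
    (by simp [zero_mem])
    (fun h₁ h₂ x y => by rw [mul_add, add_mul]; exact add_mem (h₁ x y) (h₂ x y))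
    (fun h x y => by rw [mul_neg, neg_mul]; exact neg_mem (h x y))
    (fun {w z} h x y => by simpa only [mul_assoc] using h (x * w) y)
    (fun {z w} h x y => by simpa only [mul_assoc] using h x (w * y))
  have hJ : ∀ z, z ∈ J ↔ ∀ x y, x * z * y ∈ sandwich (commSubgroup A : Set A) :=
    fun z => TwoSidedIdeal.mem_mk' ..
  have hle : TwoSidedIdeal.span (commSet A) ≤ J := by
    refine TwoSidedIdeal.span_le.2 ?_
    rintro _ ⟨c, d, rfl⟩
    exact (hJ _).2 fun x y => mul_mem_sandwich x y (lie_mem_commSubgroup c d)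
  refine addSubgroup_eq_top_of_mul_mul_mem fun x y z => ?_
  have hy : y ∈ J := hle (h ▸ trivial)
  exact (hJ y).1 hy x z

lemma Unitization.mul_inr_mul_eq_inr (x y : Unitization ℂ A) (l : A) :
    ∃ a : A, x * (l : Unitization ℂ A) * y = (a : Unitization ℂ A) :=
  ⟨(x * (l : Unitization ℂ A) * y).snd, by ext <;> simp⟩

/-- `A` is an ideal of its unitization, so multiplying `ÃLÃ` by `A` on both sides lands in `ALA`;
then `A = AAA` applies. -/
theorem coe_sandwich_unitization_eq_range_iff :
    (sandwich ((fun a : A => (a : Unitization ℂ A)) '' (commSubgroup A : Set A)) :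
        Set (Unitization ℂ A)) = Set.range (fun a : A => (a : Unitization ℂ A)) ↔
      sandwich (commSubgroup A : Set A) = ⊤ := by
  let ι : A →+ Unitization ℂ A := (Unitization.inrNonUnitalAlgHom ℂ A : A →+ Unitization ℂ A)
  have hι : ∀ a : A, ι a = (a : Unitization ℂ A) := fun a => rfl
  constructor
  · intro h
    refine addSubgroup_eq_top_of_mul_mul_mem fun x y z => ?_
    have hle : sandwich ((fun a : A => (a : Unitization ℂ A)) '' (commSubgroup A : Set A)) ≤
        ((sandwich (commSubgroup A : Set A)).map ι).comap
          ((AddMonoidHom.mulRight (z : Unitization ℂ A)).comp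
            (AddMonoidHom.mulLeft (x : Unitization ℂ A))) := by
      refine sandwich_le ?_
      rintro _ ⟨l, hl, rfl⟩ v w
      refine ⟨((x : Unitization ℂ A) * v).snd * l * (w * (z : Unitization ℂ A)).snd,
        mul_mem_sandwich _ _ hl, ?_⟩
      have e₁ : (((x : Unitization ℂ A) * v).snd : Unitization ℂ A) = x * v := by ext <;> simp
      have e₂ : ((w * (z : Unitization ℂ A)).snd : Unitization ℂ A) = w * z := by ext <;> simp
      rw [hι, Unitization.inr_mul, Unitization.inr_mul, e₁, e₂]
      simp [mul_assoc]
    have hy : (y : Unitization ℂ A) ∈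
        (sandwich ((fun a : A => (a : Unitization ℂ A)) '' (commSubgroup A : Set A)) :
          Set (Unitization ℂ A)) := h ▸ ⟨y, rfl⟩
    obtain ⟨r, hr, hry⟩ := hle hy
    have : r = x * y * z := Unitization.inr_injective (R := ℂ) (by
      rw [← hι, hry, Unitization.inr_mul, Unitization.inr_mul]; rfl)
    exact this ▸ hr
  · intro h
    refine Set.Subset.antisymm ?_ ?_
    · have : sandwich ((fun a : A => (a : Unitization ℂ A)) '' (commSubgroup A : Set A)) ≤
          ι.range := by
        refine sandwich_le ?_
        rintro _ ⟨l, _, rfl⟩ x y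
        obtain ⟨a, ha⟩ := Unitization.mul_inr_mul_eq_inr x y l
        exact ⟨a, ha.symm⟩
      exact this
    · rintro _ ⟨a, rfl⟩
      have hle : sandwich (commSubgroup A : Set A) ≤
          (sandwich ((fun a : A => (a : Unitization ℂ A)) '' (commSubgroup A : Set A))).comap ι := by
        refine sandwich_le fun l hl x y => ?_
        change ((x * l * y : A) : Unitization ℂ A) ∈
          sandwich ((fun a : A => (a : Unitization ℂ A)) '' (commSubgroup A : Set A))
        rw [Unitization.inr_mul, Unitization.inr_mul]
        exact mul_mem_sandwich _ _ ⟨l, hl, rfl⟩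
      exact hle (h ▸ AddSubgroup.mem_top a)

end Main

theorem mainTheorem3 (A : Type*) [NonUnitalCStarAlgebra A] :
    List.TFAE [
      -- (1) `A = Ã[A,A]Ã`, computed inside the unitization `Ã`
      (sandwich ((fun a : A => (a : Unitization ℂ A)) '' (commSubgroup A : Set A)) :
        Set (Unitization ℂ A)) = Set.range (fun a : A => (a : Unitization ℂ A)),
      -- (1) `A` is generated by its commutators as a (not necessarily closed) two-sided ideal
      TwoSidedIdeal.span (commSet A) = ⊤,
      -- (2) `A = A[A,A]A`
      sandwich (commSubgroup A : Set A) = ⊤,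
      -- (2) spelled out in elements
      ∀ a : A, ∃ (n : ℕ) (b c d e : Fin n → A), a = ∑ j, b j * ⁅c j, d j⁆ * e j,
      -- (3) `A = A[[A,A],[A,A]]A`
      sandwich (commSpan (commSubgroup A : Set A) (commSubgroup A : Set A) : Set A) = ⊤,
      -- (4) `A` is generated by its commutators as a ring
      NonUnitalSubring.closure (commSet A) = ⊤,
      -- (5) `A = [A,A]^2`
      mulSpan (commSubgroup A : Set A) (commSubgroup A : Set A) = ⊤,
      -- (5) spelled out in elements
      ∀ a : A, ∃ (n : ℕ) (b c d e : Fin n → A), a = ∑ j, ⁅b j, c j⁆ * ⁅d j, e j⁆]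
    -- these conditions imply (6): `A` has no character
    ∧ (mulSpan (commSubgroup A : Set A) (commSubgroup A : Set A) = ⊤ → ¬ HasCharacter A)
    -- (6) implies that `A[A,A]A` is dense in `A`
    ∧ (¬ HasCharacter A → Dense (sandwich (commSubgroup A : Set A) : Set A))
    -- if `A` is unital, then (6) is equivalent to the other conditions
    ∧ ((∃ u : A, ∀ a : A, u * a = a ∧ a * u = a) →
        (¬ HasCharacter A ↔ mulSpan (commSubgroup A : Set A) (commSubgroup A : Set A) = ⊤)) := by

  have hcomm : ∀ x y : A, ⁅x, y⁆ ∈ (commSubgroup A : Set A) := lie_mem_commSubgroup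
  refine ⟨?_, not_hasCharacter_of_mulSpan_eq_top, dense_sandwich_of_not_hasCharacter, ?_⟩
  · tfae_have 1 ↔ 3 := coe_sandwich_unitization_eq_range_iff
    tfae_have 2 → 3 := sandwich_eq_top_of_span_eq_top
    tfae_have 3 → 4 := fun h a => exists_sum_mul_lie_mul (h ▸ AddSubgroup.mem_top a)
    tfae_have 4 → 3 := fun h => by
      refine top_le_iff.1 fun a _ => ?_
      obtain ⟨n, b, c, d, e, rfl⟩ := h a
      exact sum_mem fun i _ => mul_mem_sandwich _ _ (hcomm _ _)
    tfae_have 3 → 5 := sandwich_commSpan_eq_top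
    tfae_have 5 → 7 := mulSpan_commSubgroup_eq_top
    tfae_have 7 → 8 := fun h a => exists_sum_lie_mul_lie (h ▸ AddSubgroup.mem_top a)
    tfae_have 8 → 6 := fun h => by
      refine top_le_iff.1 fun a _ => ?_
      obtain ⟨n, b, c, d, e, rfl⟩ := h a
      exact sum_mem fun i _ => mul_mem (NonUnitalSubring.subset_closure ⟨_, _, rfl⟩)
        (NonUnitalSubring.subset_closure ⟨_, _, rfl⟩)
    tfae_have 6 → 2 := fun h => by
      let I := TwoSidedIdeal.span (commSet A)
      let T : NonUnitalSubring A :=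
        { carrier := I
          add_mem' := I.add_mem
          zero_mem' := I.zero_mem
          neg_mem' := I.neg_mem
          mul_mem' := fun hx _ => I.mul_mem_right _ _ hx }
      have hle : NonUnitalSubring.closure (commSet A) ≤ T :=
        NonUnitalSubring.closure_le.2 TwoSidedIdeal.subset_span
      exact top_le_iff.1 fun a _ => hle (h ▸ NonUnitalSubring.mem_top a)
    tfae_finish
  · rintro ⟨u, hu⟩
    refine ⟨fun h => ?_, not_hasCharacter_of_mulSpan_eq_top⟩
    refine mulSpan_commSubgroup_eq_top (sandwich_commSpan_eq_top ?_)
    refine top_le_iff.1 fun b _ => ?_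
    -- The unit is a left unit for every `b`, so no approximation is needed and density becomes
    -- equality.
    by_contra hb
    exact h (hasCharacter_of_mul_eq (hu b).1 hb)
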